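/- All Lie algebras are real and finite dimensional. A complex product structure on a Lie algebra $\mathfrak g$ is a pair $\{J,E\}$ of linear endomorphisms of $\mathfrak g$ with $J^2=-\mathrm{Id}$, $E^2=\mathrm{Id}$, $E\neq\pm\mathrm{Id}$, $JE=-EJ$ such that, for all $x,y\in\mathfrak g$, $$J[x,y]=[Jx,y]+[x,Jy]+J[Jx,Jy],\qquad E[x,y]=[Ex,y]+[x,Ey]-E[Ex,Ey].$$ The eigenspaces $\mathfrak g_+$ and $\mathfrak g_-$ of $E$ for the eigenvalues $+1$ and $-1$ are then Lie subalgebras of $\mathfrak g$. A left-symmetric algebra (LSA) structure on a Lie algebra $\mathfrak h$ is a bilinear product on $\mathfrak h$ with $x\cdot(y\cdot z)-(x\cdot y)\cdot z=y\cdot(x\cdot z)-(y\cdot x)\cdot z$ and $[x,y]=x\cdot y-y\cdot x$; writing $\nabla_xy=x\cdot y$, this is the same as a flat torsion-free connection on $\mathfrak h$. It is called complete if the corresponding left-invariant connection on the simply connected Lie group with Lie algebra $\mathfrak h$ (the one with $\nabla_{X_u}X_v=X_{u\cdot v}$, where $X_u$ is the left-invariant vector field defined by $u\in\mathfrak h$)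 is geodesically complete, i.e. every tangent vector is the initial velocity of a geodesic defined on all of $\mathbb R$. **Theorem.** Let $\mathfrak g$ be a nilpotent Lie algebra with a complex product structure $\{J,E\}$. There is a unique bilinear map $\nabla:\mathfrak g\times\mathfrak g\to\mathfrak g$ such that, for all $x,y\in\mathfrak g$, $\nabla_xy-\nabla_yx=[x,y]$, $\nabla_xJy=J\nabla_xy$ and $\nabla_xEy=E\nabla_xy$. It restricts to connections $\nabla^+$ on $\mathfrak g_+$ and $\nabla^-$ on $\mathfrak g_-$, and both $\nabla^+$ and $\nabla^-$ are complete LSA structures. -/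

import Mathlib

open scoped Manifold ContDiff

universe w u

/-! ### Complex product structures on a Lie algebra -/

section Algebra

variable {g : Type*} [LieRing g] [LieAlgebra ℝ g]

/-- A complex structure on a real Lie algebra: `J² = -Id` together with integrability. -/
structure IsComplexStructure (J : g →ₗ[ℝ] g) : Prop where
  sq : ∀ x, J (J x) = -x
  integrable : ∀ x y, J ⁅x, y⁆ = ⁅J x, y⁆ + ⁅x, J y⁆ + J ⁅J x, J y⁆

/-- A product structure on a real Lie algebra: `E² = Id`, `E ≠ ±Id`, together with
integrability. -/
structure IsProductStructure (E : g →ₗ[ℝ] g) : Prop where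
  sq : ∀ x, E (E x) = x
  ne_id : E ≠ LinearMap.id
  ne_neg_id : E ≠ -LinearMap.id
  integrable : ∀ x y, E ⁅x, y⁆ = ⁅E x, y⁆ + ⁅x, E y⁆ - E ⁅E x, E y⁆

/-- A complex product structure `{J, E}`: a complex structure and a product structure which
anticommute. -/
structure IsComplexProductStructure (J E : g →ₗ[ℝ] g) : Prop where
  complex : IsComplexStructure J
  product : IsProductStructure E
  anticomm : ∀ x, J (E x) = -E (J x)

/-- The subalgebra `g₊`, the `(+1)`-eigenspace of a product structure. -/
def IsProductStructure.plus {E : g →ₗ[ℝ] g} (hE : IsProductStructure E) : LieSubalgebra ℝ g where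
  carrier := {x | E x = x}
  add_mem' := by
    intro x y hx hy
    change E x = x at hx
    change E y = y at hy
    change E (x + y) = x + y
    rw [map_add, hx, hy]
  zero_mem' := map_zero E
  smul_mem' := by
    intro c x hx
    change E x = x at hx
    change E (c • x) = c • x
    rw [map_smul, hx]
  lie_mem' := by
    intro x y hx hy
    change E x = x at hx
    change E y = y at hy
    have h := hE.integrable x y
    rw [hx, hy] at h
    have h2 : (2 : ℝ) • E ⁅x, y⁆ = (2 : ℝ) • ⁅x, y⁆ := by
      rw [two_smul, two_smul]
      exact eq_sub_iff_add_eq.mp h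
    exact smul_right_injective g (two_ne_zero : (2 : ℝ) ≠ 0) h2

/-- The subalgebra `g₋`, the `(-1)`-eigenspace of a product structure. -/
def IsProductStructure.minus {E : g →ₗ[ℝ] g} (hE : IsProductStructure E) : LieSubalgebra ℝ g where
  carrier := {x | E x = -x}
  add_mem' := by
    intro x y hx hy
    change E x = -x at hx
    change E y = -y at hy
    change E (x + y) = -(x + y)
    rw [map_add, hx, hy, neg_add]
  zero_mem' := by simp
  smul_mem' := by
    intro c x hx
    change E x = -x at hx
    change E (c • x) = -(c • x)
    rw [map_smul, hx, smul_neg]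
  lie_mem' := by
    intro x y hx hy
    change E x = -x at hx
    change E y = -y at hy
    change E ⁅x, y⁆ = -⁅x, y⁆
    have h := hE.integrable x y
    rw [hx, hy] at h
    simp only [neg_lie, lie_neg, neg_neg] at h
    have h2 : (2 : ℝ) • E ⁅x, y⁆ = (2 : ℝ) • -⁅x, y⁆ := by
      rw [two_smul, two_smul]
      exact eq_sub_iff_add_eq.mp h
    exact smul_right_injective g (two_ne_zero : (2 : ℝ) ≠ 0) h2

/-- `D x y = ∇_x y` is a torsion-free connection on the Lie algebra for which both `J` and `E` are
parallel. -/
structure IsCPConnection (J E : g →ₗ[ℝ] g) (D : g →ₗ[ℝ] g →ₗ[ℝ] g) : Prop where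
  torsionFree : ∀ x y, D x y - D y x = ⁅x, y⁆
  parallel_J : ∀ x y, D x (J y) = J (D x y)
  parallel_E : ∀ x y, D x (E y) = E (D x y)

/-- The connection induced on a totally geodesic subalgebra. -/
def inducedConnection (S : LieSubalgebra ℝ g) (D : g →ₗ[ℝ] g →ₗ[ℝ] g)
    (hS : ∀ x ∈ S, ∀ y ∈ S, D x y ∈ S) : S →ₗ[ℝ] S →ₗ[ℝ] S :=
  LinearMap.mk₂ ℝ (fun x y => ⟨D x y, hS x x.2 y y.2⟩)
    (fun x x' y => Subtype.ext (by simp))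
    (fun c x y => Subtype.ext (by simp))
    (fun x y y' => Subtype.ext (by simp))
    (fun c x y => Subtype.ext (by simp))

theorem IsCPConnection.mem_plus {J E : g →ₗ[ℝ] g} {D : g →ₗ[ℝ] g →ₗ[ℝ] g}
    (hD : IsCPConnection J E D) (hE : IsProductStructure E) :
    ∀ x ∈ hE.plus, ∀ y ∈ hE.plus, D x y ∈ hE.plus := by
  intro x _ y hy
  change E y = y at hy
  change E (D x y) = D x y
  rw [← hD.parallel_E, hy]

theorem IsCPConnection.mem_minus {J E : g →ₗ[ℝ] g} {D : g →ₗ[ℝ] g →ₗ[ℝ] g}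
    (hD : IsCPConnection J E D) (hE : IsProductStructure E) :
    ∀ x ∈ hE.minus, ∀ y ∈ hE.minus, D x y ∈ hE.minus := by
  intro x _ y hy
  change E y = -y at hy
  change E (D x y) = -D x y
  rw [← hD.parallel_E, hy, map_neg]

/-- The connection `∇⁺` induced on `g₊`. -/
def IsCPConnection.plus {J E : g →ₗ[ℝ] g} {D : g →ₗ[ℝ] g →ₗ[ℝ] g}
    (hD : IsCPConnection J E D) (hE : IsProductStructure E) :
    hE.plus →ₗ[ℝ] hE.plus →ₗ[ℝ] hE.plus :=
  inducedConnection hE.plus D (hD.mem_plus hE)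

/-- The connection `∇⁻` induced on `g₋`. -/
def IsCPConnection.minus {J E : g →ₗ[ℝ] g} {D : g →ₗ[ℝ] g →ₗ[ℝ] g}
    (hD : IsCPConnection J E D) (hE : IsProductStructure E) :
    hE.minus →ₗ[ℝ] hE.minus →ₗ[ℝ] hE.minus :=
  inducedConnection hE.minus D (hD.mem_minus hE)

/-- A left-symmetric algebra structure `x · y = L x y` on a Lie algebra, equivalently a flat
torsion-free connection `∇_x y = L x y`. -/
structure IsLSA (L : g →ₗ[ℝ] g →ₗ[ℝ] g) : Prop where
  left_symm : ∀ x y z, L x (L y z) - L (L x y) z = L y (L x z) - L (L y x) z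
  torsionFree : ∀ x y, L x y - L y x = ⁅x, y⁆

end Algebra

/-! ### Left-invariant connections on a Lie group and their geodesics -/

noncomputable section LieGroups

variable {V : Type*} [NormedAddCommGroup V] [NormedSpace ℝ V]
  {H : Type*} [TopologicalSpace H] {I : ModelWithCorners ℝ V H}
  {G : Type*} [TopologicalSpace G] [ChartedSpace H G] [Group G]

/-- A smooth real Lie group has the regularity under which its Lie algebra is defined. -/
instance instLieGroupMinSmoothnessThree [LieGroup I ∞ G] :
    LieGroup I (minSmoothness ℝ 3) G := by
  rw [minSmoothness_of_isRCLikeNormedField]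
  infer_instance

/-- The left Maurer-Cartan form: a tangent vector `w` at `a` is sent to the element `d(a⁻¹ ·) w`
of the Lie algebra, so that `w` is the value at `a` of the left-invariant vector field of this
element. -/
def maurerCartan (a : G) : TangentSpace I a →L[ℝ] GroupLieAlgebra I G :=
  ((mfderiv I I (fun b : G => a⁻¹ * b) a : V →L[ℝ] V) : V →L[ℝ] V)

/-- The differential at `1` of the left translation by `a`. -/
def leftTranslation (a : G) : GroupLieAlgebra I G →L[ℝ] TangentSpace I a :=
  (mfderiv I I (fun b : G => a * b) (1 : G) : V →L[ℝ] V)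

theorem leftTranslation_apply (a : G) (v : GroupLieAlgebra I G) :
    leftTranslation a v = mulInvariantVectorField v a := rfl

/-- A vector field on the group in the left-invariant trivialization, as a function with values
in the model vector space of the Lie algebra. -/
def leftCoord (σ : ∀ a : G, TangentSpace I a) : G → V :=
  fun b => maurerCartan b (σ b)

/-- The differential of `leftCoord σ`, with values in the Lie algebra. -/
def leftCoordDeriv (σ : ∀ a : G, TangentSpace I a) (a : G) :
    TangentSpace I a →L[ℝ] GroupLieAlgebra I G :=
  mvfderiv I (leftCoord σ) a

instance instFiniteDimensionalTangentSpaceModel [FiniteDimensional ℝ V] (a : G) :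
    FiniteDimensional ℝ (TangentSpace I a) :=
  inferInstanceAs (FiniteDimensional ℝ V)

instance instT2SpaceTangentSpaceModel (a : G) : T2Space (TangentSpace I a) :=
  inferInstanceAs (T2Space V)

variable [LieGroup I ∞ G]

theorem leftTranslation_maurerCartan (a : G) (w : TangentSpace I a) :
    leftTranslation a (maurerCartan a w) = w := by
  have hM : (∞ : ℕ∞ω) ≠ 0 := by simp
  have A : mfderiv I I ((fun x : G => a * x) ∘ (fun x => a⁻¹ * x)) a =
      ContinuousLinearMap.id ℝ (TangentSpace I a) := by
    have : (fun x : G => a * x) ∘ (fun x => a⁻¹ * x) = id := by ext x; simp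
    rw [this, mfderiv_id]
  rw [mfderiv_comp (I' := I) _ ((contMDiff_mul_left (n := ∞)).contMDiffAt.mdifferentiableAt hM)
    ((contMDiff_mul_left (n := ∞)).contMDiffAt.mdifferentiableAt hM), inv_mul_cancel] at A
  exact DFunLike.congr_fun A w

theorem maurerCartan_leftTranslation (a : G) (v : GroupLieAlgebra I G) :
    maurerCartan a (leftTranslation a v) = v := by
  have hM : (∞ : ℕ∞ω) ≠ 0 := by simp
  have A : mfderiv I I ((fun x : G => a⁻¹ * x) ∘ (fun x => a * x)) 1 =
      ContinuousLinearMap.id ℝ (TangentSpace I (1 : G)) := by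
    have : (fun x : G => a⁻¹ * x) ∘ (fun x => a * x) = id := by ext x; simp
    rw [this, mfderiv_id]
  rw [mfderiv_comp (I' := I) _ ((contMDiff_mul_left (n := ∞)).contMDiffAt.mdifferentiableAt hM)
    ((contMDiff_mul_left (n := ∞)).contMDiffAt.mdifferentiableAt hM), mul_one] at A
  exact DFunLike.congr_fun A v

theorem trivializationAt_one_snd {c : G} (hc : c = 1) (w : V) :
    (trivializationAt V (TangentSpace I) (1 : G)
      (Bundle.TotalSpace.mk' V c (w : TangentSpace I c))).2 = w := by
  subst hc
  have h2 := (tangentBundleCore I G).coordChange_self (achart H (1 : G)) 1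
    (mem_chart_source H (1 : G)) w
  exact (congrArg Prod.snd
    (TangentBundle.trivializationAt_apply (I := I) (1 : G) ⟨1, w⟩)).trans h2

theorem mdifferentiableAt_leftCoord {σ : ∀ a : G, TangentSpace I a} {a : G}
    (hσ : MDiffAt (T% σ) a) : MDifferentiableAt I 𝓘(ℝ, V) (leftCoord σ) a := by
  have hM : (∞ : ℕ∞ω) ≠ 0 := by simp
  let fg : G → TangentBundle I G := fun b => Bundle.TotalSpace.mk' V b⁻¹ 0
  have sfg : MDifferentiableAt I I.tangent fg a := by
    have h0 : ContMDiff I I.tangent ∞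
        (fun b : G => (Bundle.TotalSpace.mk' V b 0 : TangentBundle I G)) :=
      Bundle.contMDiff_zeroSection ℝ (TangentSpace I : G → Type _)
    exact ((h0.comp (contMDiff_inv I ∞)).mdifferentiable hM) a
  let S : G → TangentBundle I G := fun b =>
    tangentMap (I.prod I) I (fun p : G × G => p.1 * p.2)
      ((equivTangentBundleProd I G I G).symm (fg b, Bundle.TotalSpace.mk' V b (σ b)))
  have hS : MDifferentiableAt I I.tangent S a := by
    have S₂ : ContMDiff (I.tangent.prod I.tangent) (I.prod I).tangent 1
      (equivTangentBundleProd I G I G).symm := contMDiff_equivTangentBundleProd_symm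
    have S₃ : ContMDiff (I.prod I).tangent I.tangent 1
        (tangentMap (I.prod I) I (fun p : G × G => p.1 * p.2)) := by
      apply ContMDiff.contMDiff_tangentMap (n := ∞) (contMDiff_mul I ∞)
      norm_cast
    have h23 := ((S₃.comp S₂).mdifferentiable (by simp)) (fg a, Bundle.TotalSpace.mk' V a (σ a))
    exact h23.comp a (sfg.prodMk hσ)
  have key : ∀ b, S b = Bundle.TotalSpace.mk' V (b⁻¹ * b) (leftCoord σ b : V) := by
    intro b
    have hm : MDifferentiableAt (I.prod I) I (fun p : G × G => p.1 * p.2) (b⁻¹, b) :=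
      (contMDiff_mul I ∞).mdifferentiable hM _
    let w : V := σ b
    let v : V × V := (0, w)
    have h := mfderiv_prod_eq_add_apply (v := v) hm
    refine congrArg (Bundle.TotalSpace.mk' V (b⁻¹ * b)) (h.trans ?_)
    change mfderiv I I (fun z : G => z * b) b⁻¹ 0 + _ = _
    rw [map_zero, zero_add]
    rfl
  rw [mdifferentiableAt_totalSpace] at hS
  have h2 := hS.2
  have h1 : (S a).proj = 1 := by rw [key]; simp
  rw [h1] at h2
  refine h2.congr_of_eventuallyEq (Filter.Eventually.of_forall fun b => ?_)
  simp only [key]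
  exact (trivializationAt_one_snd (inv_mul_cancel b) _).symm

variable [FiniteDimensional ℝ V]

/-- The left-invariant connection on the Lie group determined by a bilinear product `B` on its Lie
algebra: if `X_v` is the left-invariant vector field of `v`, then `∇_{X_u} X_v = X_{B u v}`
(see `leftInvariantConnection_mulInvariantVectorField`). In the left-invariant trivialization,
`∇_w σ = dσ(w) + B w σ`. -/
def leftInvariantConnection
    (B : GroupLieAlgebra I G →ₗ[ℝ] GroupLieAlgebra I G →ₗ[ℝ] GroupLieAlgebra I G) :
    CovariantDerivative I V (fun a : G => TangentSpace I a) where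
  toFun σ a :=
    (leftTranslation a : GroupLieAlgebra I G →L[ℝ] TangentSpace I a).comp
      (leftCoordDeriv σ a +
        (LinearMap.toContinuousLinearMap
          (B.flip (maurerCartan a (σ a)))).comp (maurerCartan a))
  isCovariantDerivativeOnUniv := by
    constructor
    · intro σ σ' a hσ hσ' _
      have h : leftCoord (σ + σ') = leftCoord σ + leftCoord σ' := by
        funext b; exact map_add (maurerCartan b) _ _
      have h1 : leftCoordDeriv (σ + σ') a = leftCoordDeriv σ a + leftCoordDeriv σ' a := by
        unfold leftCoordDeriv
        rw [h, mvfderiv_add (mdifferentiableAt_leftCoord hσ) (mdifferentiableAt_leftCoord hσ')]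
        rfl
      ext w
      simp [h1]
      abel
    · intro σ f a hσ hf _
      have h : leftCoord (f • σ) = f • leftCoord σ := by
        funext b; exact map_smul (maurerCartan b) _ _
      have h1 : leftCoordDeriv (f • σ) a = f a • leftCoordDeriv σ a +
          (mvfderiv I f a).smulRight (maurerCartan a (σ a)) := by
        unfold leftCoordDeriv
        rw [h, mvfderiv_smul hf (mdifferentiableAt_leftCoord hσ)]
        rfl
      ext w
      simp [h1, leftTranslation_maurerCartan]
      abel

/-- The defining property of the left-invariant connection. -/
theorem leftInvariantConnection_mulInvariantVectorField
    (B : GroupLieAlgebra I G →ₗ[ℝ] GroupLieAlgebra I G →ₗ[ℝ] GroupLieAlgebra I G)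
    (u v : GroupLieAlgebra I G) (a : G) :
    leftInvariantConnection B (mulInvariantVectorField v) a (mulInvariantVectorField u a) =
      mulInvariantVectorField (B u v) a := by
  let v' : V := v
  have h : leftCoord (I := I) (G := G) (mulInvariantVectorField v) = fun _ => v' := by
    funext b
    exact maurerCartan_leftTranslation b v
  have h1 : leftCoordDeriv (I := I) (G := G) (mulInvariantVectorField v) a = 0 := by
    unfold leftCoordDeriv
    rw [h, mvfderiv_const]
    rfl
  simp [leftInvariantConnection, h1, ← leftTranslation_apply, maurerCartan_leftTranslation]

end LieGroups

/-! ### Geodesics -/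

noncomputable section Geodesics

variable {V : Type*} [NormedAddCommGroup V] [NormedSpace ℝ V]
  {H : Type*} [TopologicalSpace H] {I : ModelWithCorners ℝ V H}
  {G : Type*} [TopologicalSpace G] [ChartedSpace H G] [Group G]

/-- The velocity vector of a curve. -/
def velocity (γ : ℝ → G) (t : ℝ) : TangentSpace I (γ t) :=
  mfderiv 𝓘(ℝ, ℝ) I γ t (1 : ℝ)

/-- A vector field along a curve in the left-invariant trivialization. -/
def leftCoordAlong (γ : ℝ → G) (W : ∀ t, TangentSpace I (γ t)) : ℝ → V :=
  fun t => maurerCartan (γ t) (W t)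

variable [LieGroup I ∞ G]

/-- The covariant derivative `DW/dt` along a curve `γ` of a vector field `W` along `γ`, computed in
the global frame of left-invariant vector fields: if `(X_i)` is such a frame and
`W = ∑ fᵢ • (X_i ∘ γ)`, then `DW/dt = ∑ fᵢ' • (X_i ∘ γ) + ∑ fᵢ • ∇_{γ'} X_i`. -/
def covDerivAlong (cov : CovariantDerivative I V (fun a : G => TangentSpace I a))
    (γ : ℝ → G) (W : ∀ t, TangentSpace I (γ t)) (t : ℝ) : TangentSpace I (γ t) :=
  leftTranslation (γ t) (deriv (leftCoordAlong γ W) t : V) +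
    cov (mulInvariantVectorField (maurerCartan (γ t) (W t))) (γ t) (velocity γ t)

/-- A curve defined on the whole real line is a geodesic if it is twice differentiable and its
velocity field is parallel along it. -/
structure IsGeodesic (cov : CovariantDerivative I V (fun a : G => TangentSpace I a))
    (γ : ℝ → G) : Prop where
  mdifferentiable : MDifferentiable 𝓘(ℝ, ℝ) I γ
  differentiable_velocity : Differentiable ℝ (leftCoordAlong (I := I) γ (velocity γ))
  parallel : ∀ t, covDerivAlong cov γ (velocity γ) t = 0

/-- Geodesic completeness: every tangent vector is the initial velocity of a geodesic defined on
the whole real line. -/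
def IsGeodesicallyComplete
    (cov : CovariantDerivative I V (fun a : G => TangentSpace I a)) : Prop :=
  ∀ p : TangentBundle I G, ∃ γ : ℝ → G, IsGeodesic cov γ ∧
    (⟨γ 0, velocity γ 0⟩ : TangentBundle I G) = p

end Geodesics

/-! ### Completeness of a left-symmetric algebra structure -/

/-- Transport of a bilinear product along an isomorphism of Lie algebras. -/
def transportProduct {k h : Type*} [LieRing k] [LieAlgebra ℝ k] [LieRing h] [LieAlgebra ℝ h]
    (φ : k ≃ₗ⁅ℝ⁆ h) (L : h →ₗ[ℝ] h →ₗ[ℝ] h) : k →ₗ[ℝ] k →ₗ[ℝ] k :=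
  LinearMap.mk₂ ℝ (fun x y => φ.symm (L (φ x) (φ y)))
    (fun x x' y => by simp)
    (fun c x y => by simp)
    (fun x y y' => by simp)
    (fun c x y => by simp)

/-- A product `x · y = L x y` on a finite-dimensional real Lie algebra `h` is complete if the
corresponding left-invariant connection on the simply connected Lie group with Lie algebra `h` is
geodesically complete. That group, with the identification `φ` of its Lie algebra with `h`, is
unique up to isomorphism; all its models are considered. -/
def IsCompleteLSA {h : Type u} [LieRing h] [LieAlgebra ℝ h]
    (L : h →ₗ[ℝ] h →ₗ[ℝ] h) : Prop :=
  ∀ (n : ℕ) (G : Type w) [TopologicalSpace G] [ChartedSpace (EuclideanSpace ℝ (Fin n)) G]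
    [Group G] [LieGroup (𝓡 n) ∞ G] [SimplyConnectedSpace G]
    (φ : GroupLieAlgebra (𝓡 n) G ≃ₗ⁅ℝ⁆ h),
    IsGeodesicallyComplete (leftInvariantConnection (transportProduct φ L))

/-! Uniqueness: the difference of two such connections is symmetric and commutes with `J` and `E`,
hence is complex linear and `E`-linear in both arguments, and `JE = -EJ` kills it. Existence:
torsion-freeness forces an explicit formula on the eigenspaces.

For `x, z` in `g₊` parallelism and torsion-freeness give `J (D x z) = P₋ ⁅x, J z⁆`. Through `J`, the
left multiplications `L_x` of `∇⁺` thus become the action of `g₊` on `g/g₊` induced by `ad`. This is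
a representation, so `∇⁺` is flat, and `L_x` is nilpotent because `ad x` is. Hence `R_x = L_x - ad
x`, where `R_x y = y · x`, has trace zero. The same holds for `g₋` with signs exchanged.

Left symmetry upgrades trace zero to nilpotency of every `R_v`, so `1 + t R_v` is invertible for all
`t`. This solves the geodesic equation `u' = -u · u`. In affine coordinates the geodesic is the line
`t v`. The affine field `q ↦ y + y · q` takes the value `v` at `t v` exactly when `(1 + t R_v) y =
v`. If `C` solves the linear equation `C' = -C L_y`, `C 0 = 1`, then `u = C v`. Finally `γ⁻¹ γ' = u`
is solved on the group for all time, left translation giving a uniform time of existence. -/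

/-! ### Trace criterion for nilpotent right multiplications -/

section Trace

variable {K V : Type*} [Field K] [CharZero K] [AddCommGroup V] [Module K V]
  [FiniteDimensional K V]

open Polynomial in
/-- In characteristic zero, an endomorphism all of whose powers have trace zero is nilpotent. -/
theorem Module.End.isNilpotent_of_trace_pow_eq_zero (f : Module.End K V)
    (h : ∀ k : ℕ, LinearMap.trace K V (f ^ (k + 1)) = 0) : IsNilpotent f := by
  have h0 : f.charpoly ≠ 0 := f.charpoly_monic.ne_zero
  obtain ⟨s, hs, hs'⟩ := exists_eq_pow_rootMultiplicity_mul_and_not_dvd f.charpoly h0 0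
  rw [map_zero, sub_zero] at hs hs'
  set m := rootMultiplicity 0 f.charpoly
  -- The exponent `m + 1`, not `m`, leaves a factor `X` even when `m = 0`: only positive powers of
  -- `f` have known trace.
  have hcop : IsCoprime s (X ^ (m + 1)) :=
    ((Polynomial.irreducible_X.coprime_iff_not_dvd).mpr hs').symm.pow_right
  obtain ⟨a, b, hab⟩ := hcop
  have hker : aeval f (X ^ m * s) = 0 := by rw [← hs]; exact f.aeval_self_charpoly
  have hker' : aeval f (X ^ (m + 1) * s) = 0 := by
    rw [pow_succ', mul_assoc, map_mul, hker, mul_zero]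
  -- This is the Fitting projection onto the part where `f` is invertible. As a polynomial in `f`
  -- without constant term it has trace zero, so in characteristic zero it vanishes.
  have hidem : IsIdempotentElem (aeval f (b * X ^ (m + 1))) := by
    have h1 : aeval f (b * X ^ (m + 1)) * aeval f (a * s) = 0 := by
      rw [← map_mul, show b * X ^ (m + 1) * (a * s) = b * a * (X ^ (m + 1) * s) by ring, map_mul,
        hker', mul_zero]
    have h2 : aeval f (a * s) = 1 - aeval f (b * X ^ (m + 1)) := by
      rw [eq_sub_iff_add_eq, ← map_add, hab, map_one]
    rw [h2, mul_sub, mul_one, sub_eq_zero] at h1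
    exact h1.symm
  have htr : ∀ q : K[X], LinearMap.trace K V (aeval f (q * X)) = 0 := by
    intro q
    induction q using Polynomial.induction_on' with
    | add p q hp hq => rw [add_mul, map_add, map_add, hp, hq, add_zero]
    | monomial n c =>
      rw [monomial_mul_X, aeval_monomial, ← Algebra.smul_def, map_smul, h, smul_zero]
  have hzero : aeval f (b * X ^ (m + 1)) = 0 :=
    LinearMap.IsIdempotentElem.eq_zero_of_trace_eq_zero hidem (by rw [pow_succ, ← mul_assoc]; exact htr _)
  refine ⟨m, ?_⟩
  have h1 : aeval f (a * s) = 1 := by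
    rw [← add_zero (aeval f (a * s)), ← hzero, ← map_add, hab, map_one]
  have h2 : aeval f (X ^ m : K[X]) = f ^ m := by rw [map_pow, aeval_X]
  calc f ^ m = aeval f (X ^ m) * aeval f (a * s) := by rw [h1, mul_one, h2]
    _ = 0 := by
      rw [← map_mul, show X ^ m * (a * s) = a * (X ^ m * s) by ring, map_mul, hker, mul_zero]

/-- If right multiplications of a left-symmetric product have trace zero, they are nilpotent. -/
theorem isNilpotent_flip_of_trace_eq_zero (B : V →ₗ[K] V →ₗ[K] V)
    (hB : ∀ x y z, B x (B y z) - B (B x y) z = B y (B x z) - B (B y x) z)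
    (htr : ∀ x, LinearMap.trace K V (B.flip x) = 0) (v : V) :
    IsNilpotent (B.flip v : Module.End K V) := by
  -- Left symmetry read as an operator identity: `R_{x·v} = R_v R_x + [L_x, R_v]`.
  have hR : ∀ x, (B.flip (B x v) : Module.End K V) =
      B.flip v * B.flip x + (B x * B.flip v - B.flip v * B x) := by
    intro x
    ext y
    have := hB x y v
    simp only [LinearMap.flip_apply, Module.End.mul_apply, LinearMap.add_apply,
      LinearMap.sub_apply]
    rw [sub_eq_sub_iff_add_eq_add] at this
    rw [eq_comm, add_sub, sub_eq_iff_eq_add, add_comm (B (B y x) v), this]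
  -- Multiplied by `R_v ^ k`, the commutator in `hR` has trace zero, so `tr (R_v ^ (k+1) R_x) = tr
  -- (R_v ^ k R_{x·v})`.
  have hk : ∀ (k : ℕ) (x : V),
      LinearMap.trace K V ((B.flip v : Module.End K V) ^ k * B.flip x) = 0 := by
    intro k
    induction k with
    | zero => intro x; rw [pow_zero, one_mul]; exact htr x
    | succ k ih =>
      intro x
      have h1 := ih (B x v)
      have h2 : LinearMap.trace K V ((B.flip v : Module.End K V) ^ k * (B x * B.flip v)) =
          LinearMap.trace K V ((B.flip v : Module.End K V) ^ k * (B.flip v * B x)) := by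
        rw [← mul_assoc, LinearMap.trace_mul_comm, ← mul_assoc, ← mul_assoc, ← pow_succ,
          ← pow_succ']
      rwa [hR, mul_add, mul_sub, map_add, map_sub, h2, sub_self, add_zero, ← mul_assoc,
        ← pow_succ] at h1
  exact Module.End.isNilpotent_of_trace_pow_eq_zero _ fun k => by rw [pow_succ]; exact hk k v

end Trace

/-! ### The connection of a complex product structure -/

section ComplexProduct

variable {g : Type*} [LieRing g] [LieAlgebra ℝ g]

/-- The range of `P` is a model of `g/S`, and `w ↦ P ⁅x, w⁆` is the action of `S` on it. The map `J`
intertwines `D x` with this representation, which gives flatness. Abstracting `P` covers both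
eigenspaces at once. -/
theorem isLSA_inducedConnection (S : LieSubalgebra ℝ g) (D : g →ₗ[ℝ] g →ₗ[ℝ] g)
    (hS : ∀ x ∈ S, ∀ y ∈ S, D x y ∈ S) (htf : ∀ x y, D x y - D y x = ⁅x, y⁆)
    (J P : g →ₗ[ℝ] g) (hJ : Function.Injective J) (hP : ∀ x, P x = 0 ↔ x ∈ S)
    (hPP : ∀ x, P (P x) = P x) (hD : ∀ x ∈ S, ∀ z ∈ S, J (D x z) = P ⁅x, J z⁆) :
    IsLSA (inducedConnection S D hS) := by
  have hlie : ∀ x ∈ S, ∀ w, P ⁅x, P w⁆ = P ⁅x, w⁆ := by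
    intro x hx w
    have h1 : w - P w ∈ S := (hP _).mp (by rw [map_sub, hPP, sub_self])
    have h2 := (hP _).mpr (S.lie_mem hx h1)
    rw [lie_sub, map_sub, sub_eq_zero] at h2
    exact h2.symm
  refine ⟨fun x y z => Subtype.ext ?_, fun x y => Subtype.ext (htf x y)⟩
  change D x (D y z) - D (D x y) z = D y (D x z) - D (D y x) z
  have h : D x (D y z) - D y (D x z) = D ⁅(x : g), (y : g)⁆ z := by
    apply hJ
    rw [map_sub, hD x x.2 _ (hS y y.2 z z.2), hD y y.2 _ (hS x x.2 z z.2), hD y y.2 z z.2,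
      hD x x.2 z z.2, hlie x x.2, hlie y y.2, hD _ (S.lie_mem x.2 y.2) z z.2, lie_lie, map_sub]
  rw [← htf, map_sub, LinearMap.sub_apply] at h
  rw [sub_eq_sub_iff_sub_eq_sub]
  exact h

/-- By torsion-freeness `R_x = L_x - ad x` on `S`. Powers of `L_x` correspond under `J` to powers of
`ad x` modulo `S`, so both terms are nilpotent and have trace zero. -/
theorem trace_flip_inducedConnection [FiniteDimensional ℝ g] [LieRing.IsNilpotent g]
    (S : LieSubalgebra ℝ g) (D : g →ₗ[ℝ] g →ₗ[ℝ] g)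
    (hS : ∀ x ∈ S, ∀ y ∈ S, D x y ∈ S) (htf : ∀ x y, D x y - D y x = ⁅x, y⁆)
    (J P : g →ₗ[ℝ] g) (hJ : Function.Injective J) (hP : ∀ x, P x = 0 ↔ x ∈ S)
    (hPP : ∀ x, P (P x) = P x) (hPJ : ∀ z ∈ S, P (J z) = J z)
    (hD : ∀ x ∈ S, ∀ z ∈ S, J (D x z) = P ⁅x, J z⁆) (x : S) :
    LinearMap.trace ℝ S ((inducedConnection S D hS).flip x) = 0 := by
  have hlie : ∀ x ∈ S, ∀ w, P ⁅x, P w⁆ = P ⁅x, w⁆ := by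
    intro x hx w
    have h1 : w - P w ∈ S := (hP _).mp (by rw [map_sub, hPP, sub_self])
    have h2 := (hP _).mpr (S.lie_mem hx h1)
    rw [lie_sub, map_sub, sub_eq_zero] at h2
    exact h2.symm
  have hadg : IsNilpotent (LieAlgebra.ad ℝ g (x : g)) :=
    LieAlgebra.isNilpotent_iff_forall.mp inferInstance _
  have had : IsNilpotent (LieAlgebra.ad ℝ S x) := S.isNilpotent_ad_of_isNilpotent_ad hadg
  have hL : IsNilpotent (inducedConnection S D hS x : Module.End ℝ S) := by
    obtain ⟨k, hk⟩ := hadg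
    refine ⟨k, LinearMap.ext fun z => Subtype.ext (hJ ?_)⟩
    have : ∀ n : ℕ, J (((inducedConnection S D hS x : Module.End ℝ S) ^ n) z : S) =
        P ((LieAlgebra.ad ℝ g (x : g) ^ n) (J z)) := by
      intro n
      induction n with
      | zero => simp [hPJ z z.2]
      | succ n ih =>
        rw [pow_succ', pow_succ', Module.End.mul_apply, Module.End.mul_apply,
          LieAlgebra.ad_apply, ← hlie x x.2, ← ih]
        exact hD x x.2 _ (Subtype.prop _)
    rw [this, hk]
    simp
  have hR : (inducedConnection S D hS).flip x =
      inducedConnection S D hS x - LieAlgebra.ad ℝ S x := by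
    ext y
    have := htf x y
    change D y x = D x y - ⁅(x : g), (y : g)⁆
    rw [← this, sub_sub_cancel]
  rw [hR, map_sub, (LinearMap.isNilpotent_trace_of_isNilpotent hL).eq_zero,
    (LinearMap.isNilpotent_trace_of_isNilpotent had).eq_zero, sub_zero]

theorem IsCPConnection.unique {J E : g →ₗ[ℝ] g} (hJE : IsComplexProductStructure J E)
    {D D' : g →ₗ[ℝ] g →ₗ[ℝ] g} (hD : IsCPConnection J E D) (hD' : IsCPConnection J E D') :
    D' = D := by
  have hsymm : ∀ x y, (D' - D) x y = (D' - D) y x := by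
    intro x y
    have h := (hD'.torsionFree x y).trans (hD.torsionFree x y).symm
    rw [sub_eq_sub_iff_sub_eq_sub] at h
    exact h
  have hJ : ∀ x y, (D' - D) x (J y) = J ((D' - D) x y) := fun x y => by
    simp [hD.parallel_J, hD'.parallel_J]
  have hE : ∀ x y, (D' - D) x (E y) = E ((D' - D) x y) := fun x y => by
    simp [hD.parallel_E, hD'.parallel_E]
  rw [← sub_eq_zero]
  ext x y
  -- By symmetry `J` and `E` pass through either argument: both sides equal `(D' - D) (E x) (J y)`.
  have h1 : J (E ((D' - D) x y)) = E (J ((D' - D) x y)) := by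
    rw [hsymm x y, ← hE, hsymm y (E x), ← hJ, hsymm (E x) (J y), hE, hsymm (J y) x, hJ, hsymm x y]
  rw [hJE.anticomm] at h1
  have h2 : E (J ((D' - D) x y)) = 0 := by
    rw [neg_eq_iff_add_eq_zero, ← two_smul ℝ, smul_eq_zero] at h1
    exact h1.resolve_left two_ne_zero
  have h3 : J ((D' - D) x y) = 0 := by rw [← hJE.product.sq (J _), h2, map_zero]
  have h4 : (D' - D) x y = 0 := by
    rw [← neg_eq_zero, ← hJE.complex.sq ((D' - D) x y), h3, map_zero]
  exact h4

/-- The projection onto the `(+1)`-eigenspace of an involution. -/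
noncomputable def plusProj (E : g →ₗ[ℝ] g) : g →ₗ[ℝ] g := (2⁻¹ : ℝ) • (LinearMap.id + E)

/-- The projection onto the `(-1)`-eigenspace of an involution. -/
noncomputable def minusProj (E : g →ₗ[ℝ] g) : g →ₗ[ℝ] g := (2⁻¹ : ℝ) • (LinearMap.id - E)

/-- The connection of a complex product structure. -/
noncomputable def cpConnection (J E : g →ₗ[ℝ] g) : g →ₗ[ℝ] g →ₗ[ℝ] g :=
  LinearMap.mk₂ ℝ (fun x y =>
      minusProj E ⁅plusProj E x, minusProj E y⁆ + plusProj E ⁅minusProj E x, plusProj E y⁆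
      - J (minusProj E ⁅plusProj E x, J (plusProj E y)⁆)
      - J (plusProj E ⁅minusProj E x, J (minusProj E y)⁆))
    (fun x x' y => by simp only [map_add, add_lie]; abel)
    (fun c x y => by simp only [map_smul, smul_lie, smul_add, smul_sub])
    (fun x y y' => by simp only [map_add, lie_add]; abel)
    (fun c x y => by simp only [map_smul, lie_smul, smul_add, smul_sub])

theorem plusProj_add_minusProj (E : g →ₗ[ℝ] g) (x : g) : plusProj E x + minusProj E x = x := by
  simp only [plusProj, minusProj, LinearMap.smul_apply, LinearMap.add_apply, LinearMap.sub_apply,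
    LinearMap.id_apply]
  module

theorem plusProj_of_eq {E : g →ₗ[ℝ] g} {x : g} (h : E x = x) : plusProj E x = x := by
  simp only [plusProj, LinearMap.smul_apply, LinearMap.add_apply, LinearMap.id_apply, h]
  module

theorem minusProj_of_eq {E : g →ₗ[ℝ] g} {x : g} (h : E x = x) : minusProj E x = 0 := by
  simp [minusProj, h]

theorem plusProj_of_eq_neg {E : g →ₗ[ℝ] g} {x : g} (h : E x = -x) : plusProj E x = 0 := by
  simp [plusProj, h]

theorem minusProj_of_eq_neg {E : g →ₗ[ℝ] g} {x : g} (h : E x = -x) : minusProj E x = x := by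
  simp only [minusProj, LinearMap.smul_apply, LinearMap.sub_apply, LinearMap.id_apply, h]
  module

namespace IsComplexProductStructure

variable {J E : g →ₗ[ℝ] g} (hJE : IsComplexProductStructure J E)

include hJE

theorem apply_plusProj (x : g) : E (plusProj E x) = plusProj E x := by
  simp only [plusProj, LinearMap.smul_apply, LinearMap.add_apply, LinearMap.id_apply, map_smul,
    map_add, hJE.product.sq, add_comm]

theorem apply_minusProj (x : g) : E (minusProj E x) = -minusProj E x := by
  simp only [minusProj, LinearMap.smul_apply, LinearMap.sub_apply, LinearMap.id_apply, map_smul,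
    map_sub, hJE.product.sq, ← smul_neg, neg_sub]

theorem apply_J_of_eq {x : g} (h : E x = x) : E (J x) = -J x := by
  rw [eq_neg_iff_add_eq_zero, ← neg_eq_iff_add_eq_zero, ← hJE.anticomm, h]

theorem apply_J_of_eq_neg {x : g} (h : E x = -x) : E (J x) = J x := by
  rw [← neg_inj, ← hJE.anticomm, h, map_neg]

theorem minusProj_eq_zero_iff (x : g) : minusProj E x = 0 ↔ x ∈ hJE.product.plus := by
  refine ⟨fun h => ?_, minusProj_of_eq⟩
  change E x = x
  rw [← plusProj_add_minusProj E x, h, add_zero, hJE.apply_plusProj]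

theorem plusProj_eq_zero_iff (x : g) : plusProj E x = 0 ↔ x ∈ hJE.product.minus := by
  refine ⟨fun h => ?_, plusProj_of_eq_neg⟩
  change E x = -x
  rw [← plusProj_add_minusProj E x, h, zero_add, hJE.apply_minusProj]

theorem injective_J : Function.Injective J := fun x y h => by
  rw [← neg_inj, ← hJE.complex.sq, h, hJE.complex.sq]

/-- Torsion-freeness splits by eigenspaces. On mixed pairs it is the decomposition of a bracket into
its two components; on pairs of the same sign it is the integrability of `J`. -/
theorem isCPConnection_cpConnection : IsCPConnection J E (cpConnection J E) where
  parallel_E x y := by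
    have h1 : plusProj E (E y) = plusProj E y := by
      simp only [plusProj, LinearMap.smul_apply, LinearMap.add_apply, LinearMap.id_apply,
        hJE.product.sq, add_comm]
    have h2 : minusProj E (E y) = -minusProj E y := by
      simp only [minusProj, LinearMap.smul_apply, LinearMap.sub_apply, LinearMap.id_apply,
        hJE.product.sq, ← smul_neg, neg_sub]
    simp only [cpConnection, LinearMap.mk₂_apply, map_add, map_sub, h1, h2, map_neg, lie_neg,
      hJE.apply_plusProj, hJE.apply_minusProj, hJE.apply_J_of_eq (hJE.apply_plusProj _),
      hJE.apply_J_of_eq_neg (hJE.apply_minusProj _)]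
  parallel_J x y := by
    have h1 : plusProj E (J y) = J (minusProj E y) := by
      simp [plusProj, minusProj, hJE.anticomm, sub_eq_add_neg]
    have h2 : minusProj E (J y) = J (plusProj E y) := by
      simp [plusProj, minusProj, hJE.anticomm, sub_eq_add_neg]
    simp only [cpConnection, LinearMap.mk₂_apply, map_add, map_sub, h1, h2, hJE.complex.sq,
      map_neg, lie_neg]
    abel
  torsionFree x y := by
    -- Project the integrability identity to `g₋`: since `⁅J x, J y⁆` lies in `g₋`, its image under
    -- `J` lies in `g₊` and disappears.
    have hpp : ∀ x y, E x = x → E y = y →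
        J (minusProj E ⁅y, J x⁆) - J (minusProj E ⁅x, J y⁆) = ⁅x, y⁆ := by
      intro x y hx hy
      have h0 : E ⁅x, y⁆ = ⁅x, y⁆ := hJE.product.plus.lie_mem hx hy
      have h1 : E ⁅J x, J y⁆ = -⁅J x, J y⁆ :=
        hJE.product.minus.lie_mem (hJE.apply_J_of_eq hx) (hJE.apply_J_of_eq hy)
      have h2 := congrArg (minusProj E) (hJE.complex.integrable x y)
      rw [minusProj_of_eq_neg (hJE.apply_J_of_eq h0), map_add,
        minusProj_of_eq (hJE.apply_J_of_eq_neg h1), add_zero, ← lie_skew (J x) y, map_add, map_neg] at h2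
      rw [← neg_inj, ← hJE.complex.sq ⁅x, y⁆, h2, map_add, map_neg]
      abel
    have hmm : ∀ x y, E x = -x → E y = -y →
        J (plusProj E ⁅y, J x⁆) - J (plusProj E ⁅x, J y⁆) = ⁅x, y⁆ := by
      intro x y hx hy
      have h0 : E ⁅x, y⁆ = -⁅x, y⁆ := hJE.product.minus.lie_mem hx hy
      have h1 : E ⁅J x, J y⁆ = ⁅J x, J y⁆ :=
        hJE.product.plus.lie_mem (hJE.apply_J_of_eq_neg hx) (hJE.apply_J_of_eq_neg hy)
      have h2 := congrArg (plusProj E) (hJE.complex.integrable x y)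
      rw [plusProj_of_eq (hJE.apply_J_of_eq_neg h0), map_add,
        plusProj_of_eq_neg (hJE.apply_J_of_eq h1), add_zero, ← lie_skew (J x) y, map_add, map_neg] at h2
      rw [← neg_inj, ← hJE.complex.sq ⁅x, y⁆, h2, map_add, map_neg]
      abel
    have hpm : ∀ x y, minusProj E ⁅x, y⁆ - plusProj E ⁅y, x⁆ = ⁅x, y⁆ := by
      intro x y
      rw [← lie_skew x y, map_neg, ← plusProj_add_minusProj E ⁅y, x⁆]
      simp only [map_add, plusProj_of_eq (hJE.apply_plusProj _),
        minusProj_of_eq (hJE.apply_plusProj _), minusProj_of_eq_neg (hJE.apply_minusProj _),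
        plusProj_of_eq_neg (hJE.apply_minusProj _)]
      abel
    have e1 := hpp _ _ (hJE.apply_plusProj x) (hJE.apply_plusProj y)
    have e2 := hmm _ _ (hJE.apply_minusProj x) (hJE.apply_minusProj y)
    have e3 := hpm (plusProj E x) (minusProj E y)
    have e4 := hpm (plusProj E y) (minusProj E x)
    have e5 : ⁅x, y⁆ = ⁅plusProj E x, plusProj E y⁆ + ⁅minusProj E x, minusProj E y⁆ +
        ⁅plusProj E x, minusProj E y⁆ + ⁅minusProj E x, plusProj E y⁆ := by
      conv_lhs => rw [← plusProj_add_minusProj E x, ← plusProj_add_minusProj E y]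
      simp only [add_lie, lie_add]
      abel
    rw [e5, ← e1, ← e2, ← e3, ← lie_skew (minusProj E x) (plusProj E y), ← e4]
    simp only [cpConnection, LinearMap.mk₂_apply]
    abel

variable {D : g →ₗ[ℝ] g →ₗ[ℝ] g} (hD : IsCPConnection J E D)

include hD

/-- In `⁅x, J z⁆ = D x (J z) - D (J z) x` the first term lies in `g₋` and the second in `g₊`, so the
projection isolates `D x (J z) = J (D x z)`. -/
theorem J_connection_apply_plus {x z : g} (hx : E x = x) (hz : E z = z) :
    J (D x z) = minusProj E ⁅x, J z⁆ := by
  have h1 : E (D x (J z)) = -D x (J z) := by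
    rw [← hD.parallel_E, hJE.apply_J_of_eq hz, map_neg]
  have h2 : E (D (J z) x) = D (J z) x := by rw [← hD.parallel_E, hx]
  rw [← hD.parallel_J, ← hD.torsionFree, map_sub, minusProj_of_eq_neg h1, minusProj_of_eq h2,
    sub_zero]

theorem J_connection_apply_minus {x z : g} (hx : E x = -x) (hz : E z = -z) :
    J (D x z) = plusProj E ⁅x, J z⁆ := by
  have h1 : E (D x (J z)) = D x (J z) := by
    rw [← hD.parallel_E, hJE.apply_J_of_eq_neg hz]
  have h2 : E (D (J z) x) = -D (J z) x := by rw [← hD.parallel_E, hx, map_neg]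
  rw [← hD.parallel_J, ← hD.torsionFree, map_sub, plusProj_of_eq h1, plusProj_of_eq_neg h2,
    sub_zero]

theorem isLSA_plus : IsLSA (hD.plus hJE.product) :=
  isLSA_inducedConnection _ D _ hD.torsionFree J (minusProj E) hJE.injective_J
    hJE.minusProj_eq_zero_iff (fun x => minusProj_of_eq_neg (hJE.apply_minusProj x))
    fun _ hx _ hz => hJE.J_connection_apply_plus hD hx hz

theorem isLSA_minus : IsLSA (hD.minus hJE.product) :=
  isLSA_inducedConnection _ D _ hD.torsionFree J (plusProj E) hJE.injective_J
    hJE.plusProj_eq_zero_iff (fun x => plusProj_of_eq (hJE.apply_plusProj x))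
    fun _ hx _ hz => hJE.J_connection_apply_minus hD hx hz

theorem trace_flip_plus [FiniteDimensional ℝ g] [LieRing.IsNilpotent g] (x : hJE.product.plus) :
    LinearMap.trace ℝ _ ((hD.plus hJE.product).flip x) = 0 :=
  trace_flip_inducedConnection _ D _ hD.torsionFree J (minusProj E) hJE.injective_J
    hJE.minusProj_eq_zero_iff (fun x => minusProj_of_eq_neg (hJE.apply_minusProj x))
    (fun _ hz => minusProj_of_eq_neg (hJE.apply_J_of_eq hz))
    (fun _ hx _ hz => hJE.J_connection_apply_plus hD hx hz) x

theorem trace_flip_minus [FiniteDimensional ℝ g] [LieRing.IsNilpotent g] (x : hJE.product.minus) :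
    LinearMap.trace ℝ _ ((hD.minus hJE.product).flip x) = 0 :=
  trace_flip_inducedConnection _ D _ hD.torsionFree J (plusProj E) hJE.injective_J
    hJE.plusProj_eq_zero_iff (fun x => plusProj_of_eq (hJE.apply_plusProj x))
    (fun _ hz => plusProj_of_eq (hJE.apply_J_of_eq_neg hz))
    (fun _ hx _ hz => hJE.J_connection_apply_minus hD hx hz) x

end IsComplexProductStructure

end ComplexProduct

/-! ### Global solutions of `γ⁻¹ γ' = u` on a Lie group -/

section TimeDependentLeftInvariant

open Set Bundle

variable {E : Type*} [NormedAddCommGroup E] [NormedSpace ℝ E]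
  {H : Type*} [TopologicalSpace H] {I : ModelWithCorners ℝ E H}
  {G : Type*} [TopologicalSpace G] [ChartedSpace H G] [Group G]

/-- The time-dependent left-invariant vector field of a curve in the Lie algebra, as a vector field
on the product of the group with the time axis. -/
noncomputable def leftInvariantTimeField (u : ℝ → E) (p : G × ℝ) :
    TangentSpace (I.prod 𝓘(ℝ, ℝ)) p :=
  ((mulInvariantVectorField (I := I) (u p.2) p.1 : E), (1 : ℝ))

variable [LieGroup I ∞ G]

theorem contMDiff_leftInvariantTimeField {u : ℝ → E} (hu : ContDiff ℝ 1 u) :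
    ContMDiff (I.prod 𝓘(ℝ, ℝ)) (I.prod 𝓘(ℝ, ℝ)).tangent 1 (fun p : G × ℝ =>
      (⟨p, leftInvariantTimeField (I := I) u p⟩ : TangentBundle (I.prod 𝓘(ℝ, ℝ)) (G × ℝ))) := by
  have hM : (∞ : ℕ∞ω) ≠ 0 := by simp
  have sfg : ContMDiff I I.tangent 1 (fun g : G => (TotalSpace.mk' E g 0 : TangentBundle I G)) :=
    contMDiff_zeroSection _ _
  have sfv : ContMDiff 𝓘(ℝ, ℝ) I.tangent 1
      (fun s : ℝ => (TotalSpace.mk' E (1 : G) (u s) : TangentBundle I G)) := by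
    intro s
    rw [contMDiffAt_totalSpace]
    refine ⟨contMDiffAt_const, ?_⟩
    have := hu.contMDiff.contMDiffAt (x := s)
    refine this.congr_of_eventuallyEq (Filter.Eventually.of_forall fun s => ?_)
    exact trivializationAt_one_snd rfl _
  have S₂ : ContMDiff (I.tangent.prod I.tangent) (I.prod I).tangent 1
    (equivTangentBundleProd I G I G).symm := contMDiff_equivTangentBundleProd_symm
  have S₃ : ContMDiff (I.prod I).tangent I.tangent 1
      (tangentMap (I.prod I) I (fun p : G × G => p.1 * p.2)) := by
    apply ContMDiff.contMDiff_tangentMap (n := ∞) (contMDiff_mul I ∞)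
    norm_cast
  have S : ContMDiff (I.prod 𝓘(ℝ, ℝ)) I.tangent 1 (fun p : G × ℝ =>
      (⟨p.1, mulInvariantVectorField (I := I) (u p.2) p.1⟩ : TangentBundle I G)) := by
    -- The field at `(g, s)` is the differential of multiplication at `(g, 1)` applied to `(0, u
    -- s)`, so smoothness of multiplication gives its regularity.
    have h := (S₃.comp S₂).comp ((sfg.comp contMDiff_fst).prodMk (sfv.comp contMDiff_snd)
      (I := I.prod 𝓘(ℝ, ℝ)))
    convert! h with p
    · exact (mul_one _).symm
    have h1 := mfderiv_prod_eq_add_apply (v := ((0, u p.2) : E × E))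
      ((contMDiff_mul I ∞).mdifferentiable hM ((p.1, 1) : G × G))
    have h2 : mulInvariantVectorField (I := I) (u p.2) p.1 =
        mfderiv (I.prod I) I (fun q : G × G => q.1 * q.2) (p.1, 1) ((0, u p.2) : E × E) := by
      refine Eq.symm (h1.trans ?_)
      change mfderiv I I (fun z : G => z * 1) p.1 0 + _ = _
      rw [map_zero, zero_add]
      rfl
    exact h2
  have S1 : ContMDiff 𝓘(ℝ, ℝ) 𝓘(ℝ, ℝ).tangent 1
      (fun s : ℝ => (⟨s, (1 : ℝ)⟩ : TangentBundle 𝓘(ℝ, ℝ) ℝ)) := by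
    intro s
    rw [contMDiffAt_totalSpace]
    refine ⟨contMDiffAt_id, ?_⟩
    simp
    exact contMDiffAt_const
  have S₄ : ContMDiff (I.tangent.prod 𝓘(ℝ, ℝ).tangent) (I.prod 𝓘(ℝ, ℝ)).tangent 1
    (equivTangentBundleProd I G 𝓘(ℝ, ℝ) ℝ).symm := contMDiff_equivTangentBundleProd_symm
  exact S₄.comp (S.prodMk (S1.comp contMDiff_snd))

-- Two inseparable points lie in a common chart, whose injectivity and the T0 property of `H`
-- identify them; a T0 topological group is Hausdorff.
variable (I) in
include I in
theorem t2Space_of_lieGroup [T0Space H] : T2Space G := by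
  have := topologicalGroup_of_lieGroup I ∞ (G := G)
  have : T0Space G := by
    refine ⟨fun x y hxy => ?_⟩
    have hx := mem_chart_source H x
    have hy : y ∈ (chartAt H x).source :=
      (hxy.mem_open_iff (chartAt H x).open_source).mp hx
    exact (chartAt H x).injOn hx hy ((hxy.map_of_continuousAt ((chartAt H x).continuousAt hx)
      ((chartAt H x).continuousAt hy)).eq)
  infer_instance

omit [LieGroup I ∞ G] in
theorem HasMFDerivAt.leftInvariantTimeField_of_curve {u : ℝ → E} {γ : ℝ → G} {t : ℝ}
    (h : HasMFDerivAt 𝓘(ℝ, ℝ) I γ t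
      ((1 : ℝ →L[ℝ] ℝ).smulRight (mulInvariantVectorField (I := I) (u t) (γ t)))) :
    HasMFDerivAt 𝓘(ℝ, ℝ) (I.prod 𝓘(ℝ, ℝ)) (fun s => (γ s, s)) t
      ((1 : ℝ →L[ℝ] ℝ).smulRight (leftInvariantTimeField (I := I) u (γ t, t))) := by
  refine (h.prodMk (hasMFDerivAt_id t)).congr_mfderiv (ContinuousLinearMap.ext fun r => ?_)
  refine Prod.ext rfl ?_
  exact (mul_one (M := ℝ) r).symm

omit [LieGroup I ∞ G] in
theorem HasMFDerivAt.fst_of_leftInvariantTimeField {u : ℝ → E} {Γ : ℝ → G × ℝ} {t : ℝ}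
    (h : HasMFDerivAt 𝓘(ℝ, ℝ) (I.prod 𝓘(ℝ, ℝ)) Γ t
      ((1 : ℝ →L[ℝ] ℝ).smulRight (leftInvariantTimeField (I := I) u (Γ t)))) :
    HasMFDerivAt 𝓘(ℝ, ℝ) I (fun s => (Γ s).1) t
      ((1 : ℝ →L[ℝ] ℝ).smulRight (mulInvariantVectorField (I := I) (u (Γ t).2) (Γ t).1)) := by
  exact (hasMFDerivAt_fst (I := I) (I' := 𝓘(ℝ, ℝ)) (Γ t)).comp t h

omit [LieGroup I ∞ G] in
theorem HasMFDerivAt.snd_of_leftInvariantTimeField {u : ℝ → E} {Γ : ℝ → G × ℝ} {t : ℝ}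
    (h : HasMFDerivAt 𝓘(ℝ, ℝ) (I.prod 𝓘(ℝ, ℝ)) Γ t
      ((1 : ℝ →L[ℝ] ℝ).smulRight (leftInvariantTimeField (I := I) u (Γ t)))) :
    HasDerivAt (fun s => (Γ s).2) 1 t := by
  have h2 := (hasMFDerivAt_snd (I := I) (I' := 𝓘(ℝ, ℝ)) (Γ t)).comp t h
  have h3 : HasFDerivAt (fun s => (Γ s).2) (ContinuousLinearMap.id ℝ ℝ) t := by
    refine (h2.congr_mfderiv (ContinuousLinearMap.ext fun r => ?_)).hasFDerivAt
    exact mul_one (M := ℝ) r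
  exact h3.hasDerivAt

/-- Left translates of solutions are solutions, so one local solution near a time serves all initial
points at that time. -/
theorem HasMFDerivAt.mul_left_of_mulInvariantVectorField {γ : ℝ → G} {t : ℝ} {v : E}
    (h : HasMFDerivAt 𝓘(ℝ, ℝ) I γ t
      ((1 : ℝ →L[ℝ] ℝ).smulRight (mulInvariantVectorField (I := I) v (γ t)))) (g : G) :
    HasMFDerivAt 𝓘(ℝ, ℝ) I (fun s => g * γ s) t
      ((1 : ℝ →L[ℝ] ℝ).smulRight (mulInvariantVectorField (I := I) v (g * γ t))) := by
  have hM : (∞ : ℕ∞ω) ≠ 0 := by simp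
  have hd : ∀ a b : G, MDifferentiableAt I I (fun x : G => a * x) b := fun a b =>
    (contMDiff_mul_left (n := ∞)).contMDiffAt.mdifferentiableAt hM
  have h2 := (hd g (γ t)).hasMFDerivAt.comp t h
  have h3 : mulInvariantVectorField (I := I) v (g * γ t) =
      mfderiv I I (fun x : G => g * x) (γ t) (mulInvariantVectorField (I := I) v (γ t)) := by
    have A : mfderiv I I (fun x => g * γ t * x) (1 : G) =
        mfderiv I I ((fun x : G => g * x) ∘ fun x => γ t * x) 1 := by
      congr 1
      ext x
      simp [mul_assoc]
    rw [mfderiv_comp (I' := I) _ (hd _ _) (hd _ _)] at A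
    have B := DFunLike.congr_fun A v
    rw [show mulInvariantVectorField (I := I) v (g * γ t) =
      mfderiv I I (fun x => g * γ t * x) (1 : G) v from rfl]
    refine B.trans ?_
    change mfderiv I I (fun x : G => g * x) (γ t * 1) _ = _
    rw [mul_one]
    rfl
  rw [h3]
  refine h2.congr_mfderiv (ContinuousLinearMap.ext fun r => ?_)
  let c : ℝ := r
  exact map_smul (mfderiv I I (fun x : G => g * x) (γ t)) c _


theorem eqOn_id_of_hasDerivAt_one {f : ℝ → ℝ} {S : Set ℝ} (hS : IsOpen S) (hS' : IsPreconnected S)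
    (hf : ∀ t ∈ S, HasDerivAt f 1 t) {s : ℝ} (hs : s ∈ S) (h : f s = s) : ∀ t ∈ S, f t = t := by
  refine hS.eqOn_of_deriv_eq (g := fun t => t) hS'
    (fun t ht => (hf t ht).differentiableAt.differentiableWithinAt) differentiableOn_id ?_ hs h
  intro t ht
  rw [(hf t ht).deriv]
  simp

/-- A left-invariant equation `γ⁻¹ γ' = u t` is solvable near every time. -/
theorem exists_local_leftInvariant_curve [CompleteSpace E] [BoundarylessManifold I G] {u : ℝ → E}
    (hu : ContDiff ℝ 1 u) (s : ℝ) : ∃ ε > 0, ∃ γ : ℝ → G, ∀ t ∈ Metric.ball s ε,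
      HasMFDerivAt 𝓘(ℝ, ℝ) I γ t
        ((1 : ℝ →L[ℝ] ℝ).smulRight (mulInvariantVectorField (I := I) (u t) (γ t))) := by
  have : IsManifold I 1 G := IsManifold.of_le (n := ∞) (by norm_cast)
  obtain ⟨Γ, hΓ, hc⟩ := exists_isMIntegralCurveAt_of_contMDiffAt_boundaryless (t₀ := s)
    ((contMDiff_leftInvariantTimeField (I := I) (G := G) hu).contMDiffAt (x := (1, s)))
  obtain ⟨ε, hε, hball⟩ := Metric.eventually_nhds_iff_ball.mp hc
  have htime : ∀ t ∈ Metric.ball s ε, (Γ t).2 = t :=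
    eqOn_id_of_hasDerivAt_one Metric.isOpen_ball (convex_ball s ε).isPreconnected
      (fun t ht => (hball t ht).snd_of_leftInvariantTimeField) (Metric.mem_ball_self hε) (by rw [hΓ])
  refine ⟨ε, hε, fun t => (Γ t).1, fun t ht => ?_⟩
  have := (hball t ht).fst_of_leftInvariantTimeField
  rwa [htime t ht] at this

/-- A left-invariant equation `γ⁻¹ γ' = u t` whose right-hand side has compact support has global
solutions, since by left invariance the time of existence can be chosen uniformly. -/
theorem exists_leftInvariant_curve_of_hasCompactSupport [CompleteSpace E] [BoundarylessManifold I G]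
    [T2Space G] {u : ℝ → E} (hu : ContDiff ℝ 1 u) (hc : HasCompactSupport u) (a : G) :
    ∃ γ : ℝ → G, γ 0 = a ∧ ∀ t, HasMFDerivAt 𝓘(ℝ, ℝ) I γ t
        ((1 : ℝ →L[ℝ] ℝ).smulRight (mulInvariantVectorField (I := I) (u t) (γ t))) := by
  have : IsManifold I 1 G := IsManifold.of_le (n := ∞) (by norm_cast)
  choose ε hε γ hγ using exists_local_leftInvariant_curve (I := I) (G := G) hu
  obtain ⟨δ, hδ, hball⟩ := lebesgue_number_lemma_of_metric (c := fun s => Metric.ball s (ε s))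
    (hc.cthickening (r := 1)) (fun _ => Metric.isOpen_ball)
    fun s _ => mem_iUnion.mpr ⟨s, Metric.mem_ball_self (hε s)⟩
  have hlocal : ∀ s, ∃ c : ℝ → G, ∀ t ∈ Metric.ball s (min δ 1), HasMFDerivAt 𝓘(ℝ, ℝ) I c t
      ((1 : ℝ →L[ℝ] ℝ).smulRight (mulInvariantVectorField (I := I) (u t) (c t))) := by
    intro s
    by_cases hs : s ∈ Metric.cthickening 1 (tsupport u)
    · obtain ⟨s', hs'⟩ := hball s hs
      exact ⟨γ s', fun t ht => hγ s' t (hs' (Metric.ball_subset_ball (min_le_left _ _) ht))⟩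
    -- At distance more than `1` from the support, `u` vanishes on the unit ball and constant curves
    -- are solutions.
    · refine ⟨fun _ => a, fun t ht => ?_⟩
      have hut : u t = 0 := by
        by_contra hne
        refine hs (Metric.mem_cthickening_of_dist_le s t 1 _ (subset_tsupport u hne) ?_)
        rw [dist_comm]
        exact (lt_of_lt_of_le ht (min_le_right _ _)).le
      refine (hasMFDerivAt_const a t).congr_mfderiv (ContinuousLinearMap.ext fun r => ?_)
      rw [hut]
      have h0 : mulInvariantVectorField (I := I) (0 : E) a = 0 :=
        map_zero (mfderiv I I (fun x : G => a * x) (1 : G))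
      rw [h0]
      exact (smul_zero (M := ℝ) (A := E) r).symm
  obtain ⟨Γ, hΓ, hint⟩ := exists_isMIntegralCurve_of_isMIntegralCurveOn
    -- The local solution `c` is translated by `p.1 * (c p.2)⁻¹` so as to pass through `p.1` at time
    -- `p.2`.
    (contMDiff_leftInvariantTimeField (I := I) (G := G) hu) (lt_min hδ one_pos) (fun p => by
      obtain ⟨c, hcurve⟩ := hlocal p.2
      have h1 : IsMIntegralCurveOn (fun t => (p.1 * (c p.2)⁻¹ * c t, t))
          (leftInvariantTimeField (I := I) u) (Metric.ball p.2 (min δ 1)) := fun t ht =>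
        (((hcurve t ht).mul_left_of_mulInvariantVectorField
          (p.1 * (c p.2)⁻¹)).leftInvariantTimeField_of_curve).hasMFDerivWithinAt
      refine ⟨_, ?_, (h1.comp_add p.2).mono ?_⟩
      · simp
      · intro t ht
        rw [mem_ofPred_eq, Metric.mem_ball, Real.dist_eq, add_sub_cancel_right]
        exact abs_lt.mpr ht) (a, 0)
  have htime : ∀ t, (Γ t).2 = t := fun t =>
    eqOn_id_of_hasDerivAt_one isOpen_univ isPreconnected_univ
      (fun t _ => (hint t).snd_of_leftInvariantTimeField) (mem_univ 0) (by rw [hΓ]) t (mem_univ t)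
  refine ⟨fun t => (Γ t).1, congrArg Prod.fst hΓ, fun t => ?_⟩
  have := (hint t).fst_of_leftInvariantTimeField
  rwa [htime t] at this

/-- A left-invariant equation `γ⁻¹ γ' = u t` on a Lie group has global solutions. -/
theorem exists_leftInvariant_curve [CompleteSpace E] [BoundarylessManifold I G]
    [T2Space G] {u : ℝ → E} (hu : ContDiff ℝ 1 u) (a : G) :
    ∃ γ : ℝ → G, γ 0 = a ∧ ∀ t, HasMFDerivAt 𝓘(ℝ, ℝ) I γ t
        ((1 : ℝ →L[ℝ] ℝ).smulRight (mulInvariantVectorField (I := I) (u t) (γ t))) := by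
  have : IsManifold I 1 G := IsManifold.of_le (n := ∞) (by norm_cast)
  obtain ⟨Γ, hΓ, hint⟩ := (exists_isMIntegralCurve_iff_exists_isMIntegralCurveOn_Ioo
    (contMDiff_leftInvariantTimeField (I := I) (G := G) hu) (a, 0)).mpr fun T => by
      -- The cutoff equals `1` on `(-T, T)`, so the compactly supported equation agrees with the
      -- original one there.
      let χ : ContDiffBump (0 : ℝ) := ⟨|T| + 1, |T| + 2, by positivity, by linarith⟩
      obtain ⟨γ, hγ0, hγ⟩ := exists_leftInvariant_curve_of_hasCompactSupport (I := I)
        (χ.contDiff.smul hu) (χ.hasCompactSupport.smul_right (f' := u)) a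
      refine ⟨fun t => (γ t, t), by simp [hγ0], fun t ht => ?_⟩
      have h1 := hγ t
      have ht' : t ∈ Metric.closedBall (0 : ℝ) χ.rIn := by
        rw [mem_closedBall_zero_iff, Real.norm_eq_abs]
        change |t| ≤ |T| + 1
        have := abs_lt.mpr ht
        linarith [le_abs_self T]
      have h2 : (χ t) • u t = u t := by rw [χ.one_of_mem_closedBall ht', one_smul]
      rw [Pi.smul_apply', h2] at h1
      exact h1.leftInvariantTimeField_of_curve.hasMFDerivWithinAt
  have htime : ∀ t, (Γ t).2 = t := fun t =>
    eqOn_id_of_hasDerivAt_one isOpen_univ isPreconnected_univ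
      (fun t _ => (hint t).snd_of_leftInvariantTimeField) (mem_univ 0) (by rw [hΓ]) t (mem_univ t)
  refine ⟨fun t => (Γ t).1, congrArg Prod.fst hΓ, fun t => ?_⟩
  have := (hint t).fst_of_leftInvariantTimeField
  rwa [htime t] at this

end TimeDependentLeftInvariant

/-! ### Linear equations as left-invariant equations on `Rˣ` -/

section LinearODE

open scoped Topology

variable {R : Type*} [NormedRing R] [CompleteSpace R] [NormedAlgebra ℝ R]

/-- The inclusion into `R` is itself the chart of the unit group, so in coordinates it is the
identity. -/
theorem hasMFDerivAt_units_val (a : Rˣ) :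
    HasMFDerivAt 𝓘(ℝ, R) 𝓘(ℝ, R) (Units.val : Rˣ → R) a (ContinuousLinearMap.id ℝ R) := by
  refine ⟨Units.continuous_val.continuousAt, ?_⟩
  have h : ∀ᶠ x in 𝓝 (a : R), Units.val ((chartAt R a).symm x) = x := by
    filter_upwards [(chartAt R a).open_target.mem_nhds (mem_chart_target R a)] with x hx
    exact (chartAt R a).right_inv hx
  exact ((hasFDerivAt_id (a : R)).congr_of_eventuallyEq h).hasFDerivWithinAt

theorem mulInvariantVectorField_units (a : Rˣ) (w : R) :
    mulInvariantVectorField (I := 𝓘(ℝ, R)) w a = (a : R) * w := by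
  have hM : (∞ : ℕ∞ω) ≠ 0 := by simp
  have hd : MDifferentiableAt 𝓘(ℝ, R) 𝓘(ℝ, R) (fun x : Rˣ => a * x) 1 :=
    (contMDiff_mul_left (n := ∞)).contMDiffAt.mdifferentiableAt hM
  have h1 := (hasMFDerivAt_units_val (a * 1)).comp (1 : Rˣ) hd.hasMFDerivAt
  have h2 := (((ContinuousLinearMap.mul ℝ R (a : R)).hasFDerivAt
    (x := ((1 : Rˣ) : R))).hasMFDerivAt).comp (1 : Rˣ) (hasMFDerivAt_units_val 1)
  have h3 := hasMFDerivAt_unique h1 h2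
  exact DFunLike.congr_fun h3 w

/-- The linear differential equation `C' = C w` has a global invertible solution. -/
theorem exists_units_hasDerivAt_mul {w : ℝ → R} (hw : ContDiff ℝ 1 w) :
    ∃ C : ℝ → Rˣ, C 0 = 1 ∧ ∀ t, HasDerivAt (fun t => (C t : R)) (C t * w t) t := by
  obtain ⟨C, hC0, hC⟩ := exists_leftInvariant_curve (I := 𝓘(ℝ, R)) (G := Rˣ) hw 1
  refine ⟨C, hC0, fun t => ?_⟩
  have h1 := ((hasMFDerivAt_units_val (C t)).comp t (hC t)).hasFDerivAt
  have h2 : HasFDerivAt (fun t => (C t : R))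
      ((1 : ℝ →L[ℝ] ℝ).smulRight ((C t : R) * w t)) t := by
    rw [← mulInvariantVectorField_units]
    exact h1
  simpa using h2.hasDerivAt

theorem HasDerivAt.ringInverse {f : ℝ → R} {f' : R} {t : ℝ} (hf : HasDerivAt f f' t)
    (hu : IsUnit (f t)) : HasDerivAt (fun s => Ring.inverse (f s))
      (-(Ring.inverse (f t) * f' * Ring.inverse (f t))) t := by
  obtain ⟨a, ha⟩ := hu
  have h := hasFDerivAt_ringInverse (𝕜 := ℝ) a
  rw [ha] at h
  rw [← ha, Ring.inverse_unit]
  exact h.comp_hasDerivAt t hf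

end LinearODE

/-! ### The geodesic equation in the Lie algebra -/

section Geodesic

variable {V : Type*} [NormedAddCommGroup V] [NormedSpace ℝ V] [CompleteSpace V]

/-- The geodesic equation `u' = -u · u` of a left-symmetric product with nilpotent right
multiplications has global solutions. -/
theorem exists_geodesic_velocity_of_isNilpotent_flip (L : V →L[ℝ] V →L[ℝ] V)
    (hL : ∀ x y z, L x (L y z) - L (L x y) z = L y (L x z) - L (L y x) z) (v : V)
    (hv : IsNilpotent (L.flip v)) :
    ∃ u : ℝ → V, u 0 = v ∧ ∀ t, HasDerivAt u (-L (u t) (u t)) t := by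
  have hLie : ∀ x y, L (L x y - L y x) = L x * L y - L y * L x := by
    intro x y
    ext z
    have := hL x y z
    simp only [map_sub, sub_apply, mul_apply_eq_comp]
    rw [sub_eq_sub_iff_sub_eq_sub] at this
    exact this.symm
  have hR : ∀ x q, L.flip (L x q) = L.flip q * L.flip x + (L x * L.flip q - L.flip q * L x) := by
    intro x q
    ext y
    have := hL x y q
    simp only [ContinuousLinearMap.flip_apply, mul_apply_eq_comp,
      add_apply, sub_apply]
    rw [sub_eq_sub_iff_add_eq_add] at this
    rw [eq_comm, add_sub, sub_eq_iff_eq_add, add_comm (L (L y x) q), this]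
  let M : ℝ → V →L[ℝ] V := fun t => 1 + t • L.flip v
  have hM : ∀ t, IsUnit (M t) := fun t => (hv.smul t).isUnit_one_add
  have hMd : ∀ t, HasDerivAt M (L.flip v) t := fun t => by
    exact (((hasDerivAt_id t).smul_const (L.flip v)).const_add (1 : V →L[ℝ] V)).congr_deriv
      (one_smul ℝ _)
  let W : ℝ → V →L[ℝ] V := fun t => Ring.inverse (M t)
  have hWd : ∀ t, HasDerivAt W (-(W t * L.flip v * W t)) t := fun t => (hMd t).ringInverse (hM t)
  have hMW : ∀ t, M t * W t = 1 := fun t => Ring.mul_inverse_cancel _ (hM t)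
  have hWM : ∀ t, W t * M t = 1 := fun t => Ring.inverse_mul_cancel _ (hM t)
  have hWsmooth : ContDiff ℝ 1 W := by
    rw [contDiff_iff_contDiffAt]
    intro t
    obtain ⟨a, ha⟩ := hM t
    have h1 : ContDiffAt ℝ 1 Ring.inverse (M t) := ha ▸ contDiffAt_ringInverse ℝ a
    exact h1.comp t (contDiff_const.add (contDiff_id.smul contDiff_const)).contDiffAt
  -- `y t` is the right-invariant velocity of the geodesic: its affine field has value `v` at the
  -- point `t v`.
  let y : ℝ → V := fun t => W t v
  have hy : ∀ t, M t (y t) = v := fun t => DFunLike.congr_fun (hMW t) v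
  have hcomm : ∀ t, L.flip v = M t * L.flip (y t) + (L (y t) * M t - M t * L (y t)) := by
    intro t
    have h1 := hR (y t) (t • v)
    have h2 : v = y t + L (y t) (t • v) := by
      conv_lhs => rw [← hy t]
      simp [M]
    conv_lhs => rw [h2, map_add, h1]
    simp only [M, map_smul]
    noncomm_ring
  -- The inverse `Z` of `C` satisfies `Z' = L_y Z`: it is the linear part of the affine motion along
  -- the geodesic.
  obtain ⟨C, hC0, hC⟩ := exists_units_hasDerivAt_mul (w := fun t => -L (y t))
    (L.contDiff.comp (hWsmooth.clm_apply contDiff_const)).neg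
  let Z : ℝ → V →L[ℝ] V := fun t => ↑(C t)⁻¹
  have hZC : ∀ t, Z t * (C t : V →L[ℝ] V) = 1 := fun t => (C t).inv_mul
  have hZd : ∀ t, HasDerivAt Z (L (y t) * Z t) t := by
    intro t
    have h := (hC t).ringInverse (C t).isUnit
    simp only [Ring.inverse_unit] at h
    convert! h using 1
    change _ = -(Z t * (C t * -L (y t)) * Z t)
    rw [← mul_assoc, hZC, one_mul, neg_mul, neg_neg]
  -- `W Z` plays the role of `Ad γ`: it satisfies `(W Z)' = ad_y (W Z)`, as `ad_y = L_y - R_y`.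
  have hWZd : ∀ t, HasDerivAt (fun s => W s * Z s)
      ((L (y t) - L.flip (y t)) * (W t * Z t)) t := by
    intro t
    convert! (hWd t).mul (hZd t) using 1
    have h1 : W t * (M t * L.flip (y t) + (L (y t) * M t - M t * L (y t))) * W t =
        L.flip (y t) * W t + (W t * L (y t) - L (y t) * W t) := by
      calc _ = (W t * M t) * L.flip (y t) * W t + (W t * L (y t) * (M t * W t)
            - (W t * M t) * L (y t) * W t) := by noncomm_ring
        _ = _ := by rw [hMW, hWM]; noncomm_ring
    rw [hcomm t, h1]
    noncomm_ring
  -- Equivariance `L_{Ad x} = Z L_x Z⁻¹`: the left side has derivative zero, because `L` is a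
  -- representation (`hLie`), and equals `L x` at `t = 0`.
  have hconj : ∀ t x, (C t : V →L[ℝ] V) * L ((W t * Z t) x) * Z t = L x := by
    intro t x
    have hd : ∀ s, HasDerivAt (fun s => (C s : V →L[ℝ] V) * L ((W s * Z s) x) * Z s) 0 s := by
      intro s
      have h1 : HasDerivAt (fun s => L ((W s * Z s) x))
          (L (((L (y s) - L.flip (y s)) * (W s * Z s)) x)) s :=
        L.hasFDerivAt.comp_hasDerivAt s
          ((hWZd s).clm_apply (hasDerivAt_const s x) |>.congr_deriv (by simp))
      refine (((hC s).mul h1).mul (hZd s)).congr_deriv ?_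
      have h2 := hLie (y s) ((W s * Z s) x)
      have h3 : ((L (y s) - L.flip (y s)) * (W s * Z s)) x =
          L (y s) ((W s * Z s) x) - L ((W s * Z s) x) (y s) := by simp
      rw [h3, h2, Pi.mul_apply]
      noncomm_ring
    have h0 := is_const_of_deriv_eq_zero (fun s => (hd s).differentiableAt)
      (fun s => (hd s).deriv) t 0
    refine h0.trans ?_
    simp [Z, W, M, hC0]
  -- For `u = C v` one has `W Z u = y`, so `hconj` gives `C L_y Z = L_u` and `u' = -C L_y v = -L_u
  -- (C v) = -u · u`.
  refine ⟨fun t => (C t : V →L[ℝ] V) v, by simp [hC0], fun t => ?_⟩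
  refine ((hC t).clm_apply (hasDerivAt_const t v)).congr_deriv ?_
  have h1 : (W t * Z t) ((C t : V →L[ℝ] V) v) = y t := by
    change W t ((Z t * (C t : V →L[ℝ] V)) v) = y t
    rw [hZC]
    rfl
  have h2 := hconj t ((C t : V →L[ℝ] V) v)
  rw [h1] at h2
  rw [← h2]
  have h3 : Z t ((C t : V →L[ℝ] V) v) = v := DFunLike.congr_fun (hZC t) v
  simp [h3]

theorem exists_geodesic_velocity_of_trace_flip_eq_zero [FiniteDimensional ℝ V]
    (B : V →ₗ[ℝ] V →ₗ[ℝ] V)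
    (hB : ∀ x y z, B x (B y z) - B (B x y) z = B y (B x z) - B (B y x) z)
    (htr : ∀ x, LinearMap.trace ℝ V (B.flip x) = 0) (v : V) :
    ∃ u : ℝ → V, u 0 = v ∧ ∀ t, HasDerivAt u (-B (u t) (u t)) t := by
  let L : V →L[ℝ] V →L[ℝ] V := LinearMap.toContinuousLinearMap
    ((LinearMap.toContinuousLinearMap (𝕜 := ℝ) (E := V) (F' := V)).toLinearMap ∘ₗ B)
  have hv : IsNilpotent (L.flip v) := by
    obtain ⟨k, hk⟩ := isNilpotent_flip_of_trace_eq_zero B hB htr v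
    refine ⟨k, ContinuousLinearMap.coe_injective ?_⟩
    rw [ContinuousLinearMap.toLinearMap_pow]
    exact hk
  exact exists_geodesic_velocity_of_isNilpotent_flip L hB v hv

-- Bootstrapping: `u` is continuous, so its derivative, quadratic in `u`, is continuous too.
omit [CompleteSpace V] in
theorem contDiff_one_of_geodesic_velocity [FiniteDimensional ℝ V] (B : V →ₗ[ℝ] V →ₗ[ℝ] V)
    {u : ℝ → V} (hu : ∀ t, HasDerivAt u (-B (u t) (u t)) t) : ContDiff ℝ 1 u := by
  let L : V →L[ℝ] V →L[ℝ] V := LinearMap.toContinuousLinearMap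
    ((LinearMap.toContinuousLinearMap (𝕜 := ℝ) (E := V) (F' := V)).toLinearMap ∘ₗ B)
  have hd : Differentiable ℝ u := fun t => (hu t).differentiableAt
  have hderiv : deriv u = fun t => -L (u t) (u t) := funext fun t => (hu t).deriv
  rw [contDiff_one_iff_deriv]
  refine ⟨hd, ?_⟩
  rw [hderiv]
  exact ((L.continuous.comp hd.continuous).clm_apply hd.continuous).neg

end Geodesic

/-! ### Geodesic completeness and the main theorem -/

section Completeness

variable {V : Type*} [NormedAddCommGroup V] [NormedSpace ℝ V] [FiniteDimensional ℝ V]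
  {H : Type*} [TopologicalSpace H] {I : ModelWithCorners ℝ V H}
  {G : Type*} [TopologicalSpace G] [ChartedSpace H G] [Group G] [LieGroup I ∞ G]

/-- In the left trivialization the geodesic equation decouples: first `u' = -B u u` in the Lie
algebra, then `γ⁻¹ γ' = u` on the group. -/
theorem isGeodesicallyComplete_leftInvariantConnection [T2Space G] [BoundarylessManifold I G]
    (B : GroupLieAlgebra I G →ₗ[ℝ] GroupLieAlgebra I G →ₗ[ℝ] GroupLieAlgebra I G)
    (hB : ∀ x y z, B x (B y z) - B (B x y) z = B y (B x z) - B (B y x) z)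
    (htr : ∀ x, LinearMap.trace ℝ (GroupLieAlgebra I G) (B.flip x) = 0) :
    IsGeodesicallyComplete (leftInvariantConnection B) := by
  have : CompleteSpace V := FiniteDimensional.complete ℝ V
  rintro ⟨a, p⟩
  let B' : V →ₗ[ℝ] V →ₗ[ℝ] V := B
  obtain ⟨u, hu0, hu⟩ := exists_geodesic_velocity_of_trace_flip_eq_zero B' hB htr
    (maurerCartan (I := I) a p : V)
  obtain ⟨γ, hγ0, hγ⟩ := exists_leftInvariant_curve (I := I) (G := G)
    (contDiff_one_of_geodesic_velocity B' hu) a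
  have hvel : ∀ t, velocity (I := I) γ t = leftTranslation (γ t) (u t) := by
    intro t
    unfold velocity
    rw [(hγ t).mfderiv]
    exact one_smul (α := V) ℝ _
  have hcoord : leftCoordAlong (I := I) γ (velocity γ) = u := by
    funext t
    unfold leftCoordAlong
    rw [hvel]
    exact maurerCartan_leftTranslation _ _
  refine ⟨γ, ⟨fun t => (hγ t).mdifferentiableAt, ?_, fun t => ?_⟩, ?_⟩
  · rw [hcoord]
    exact fun t => (hu t).differentiableAt
  · unfold covDerivAlong
    have h1 : maurerCartan (I := I) (γ t) (velocity γ t) = u t := congrFun hcoord t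
    rw [hcoord, (hu t).deriv, h1, hvel, leftTranslation_apply (γ t) (u t)]
    have h2 : ∀ w : GroupLieAlgebra I G,
        leftTranslation (γ t) (-w) + mulInvariantVectorField w (γ t) = 0 := fun w => by
      rw [map_neg, leftTranslation_apply, neg_add_cancel]
    exact (congrArg (leftTranslation (I := I) (γ t) (-B (u t) (u t)) + ·)
      (leftInvariantConnection_mulInvariantVectorField B (u t) (u t) (γ t))).trans (h2 _)
  · subst hγ0
    have : velocity (I := I) γ 0 = p := by
      rw [hvel, hu0]
      exact leftTranslation_maurerCartan _ _
    rw [this]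

end Completeness

theorem isCompleteLSA_of_trace_flip_eq_zero {h : Type u} [LieRing h] [LieAlgebra ℝ h]
    {L : h →ₗ[ℝ] h →ₗ[ℝ] h} (hL : IsLSA L) (htr : ∀ x, LinearMap.trace ℝ h (L.flip x) = 0) :
    IsCompleteLSA.{w} L := by
  intro n G _ _ _ _ _ φ
  have : T2Space G := t2Space_of_lieGroup (𝓡 n)
  refine isGeodesicallyComplete_leftInvariantConnection _ (fun x y z => ?_) fun x => ?_
  · have h1 := congrArg φ.symm (hL.left_symm (φ x) (φ y) (φ z))
    simpa [transportProduct] using h1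
  -- The transported right multiplication by `x` is the conjugate under `φ` of that by `φ x`.
  · have h1 := LinearMap.trace_conj' (L.flip (φ x)) φ.symm.toLinearEquiv
    rw [htr] at h1
    rw [← h1]
    rfl

theorem theorem3p3 {g : Type u} [LieRing g] [LieAlgebra ℝ g] [FiniteDimensional ℝ g]
    [LieRing.IsNilpotent g] (J E : g →ₗ[ℝ] g) (hJE : IsComplexProductStructure J E) :
    ∃ (D : g →ₗ[ℝ] g →ₗ[ℝ] g) (hD : IsCPConnection J E D),
      (∀ D' : g →ₗ[ℝ] g →ₗ[ℝ] g, IsCPConnection J E D' → D' = D) ∧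
      (IsLSA (hD.plus hJE.product) ∧ IsCompleteLSA.{w} (hD.plus hJE.product)) ∧
      (IsLSA (hD.minus hJE.product) ∧ IsCompleteLSA.{w} (hD.minus hJE.product)) := by
  have hD := hJE.isCPConnection_cpConnection
  refine ⟨cpConnection J E, hD, fun D' hD' => hD.unique hJE hD', ?_, ?_⟩
  · exact ⟨hJE.isLSA_plus hD,
      isCompleteLSA_of_trace_flip_eq_zero (hJE.isLSA_plus hD) (hJE.trace_flip_plus hD)⟩
  · exact ⟨hJE.isLSA_minus hD,
      isCompleteLSA_of_trace_flip_eq_zero (hJE.isLSA_minus hD) (hJE.trace_flip_minus hD)⟩
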